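/- Let $D,N\ge 1$ and $P\ge 0$ be integers, let $f_1,\dots,f_P:\mathbb{R}^D\to\{0,1\}$ be given measurable functions (partition activeness functions) and $f_0\equiv 1$. For a weight matrix $A=(a_0,a_1,\dots,a_P)\in\mathbb{R}^{D\times(P+1)}$ with entries $a_{dp}$ put $$g_A(x)=\sum_{p=0}^{P} f_p(x)\sum_{d=1}^{D}a_{dp}x_d,\qquad \Omega_{group}(A)=\sum_{p=1}^{P}\|a_p\|_q+\sum_{p=0}^{P}\sum_{d=1}^{D}|a_{dp}|,$$ where $q\in[1,\infty]$ is arbitrary ($q=2$ gives the overlapping group lasso with Euclidean group norms, $q=\infty$ the version with maximum norms), and let $\mathcal{A}=\{A:\Omega_{group}(A)\le 1\}$. Let $\mathcal{D}$ be a probability distribution of pairs $(x,y)$, $x\in\mathbb{R}^D$, $y$ in a measurable space, with $\|x\|_\infty\le 1$ almost surely, and let $(x_1,y_1),\dots,(x_N,y_N)$ be i.i.d. samples from $\mathcal{D}$. Let $\ell(y,t)\in[0,1]$ be a measurable loss function, defined for all labels $y$ and all $t\in\mathbb{R}$, such that $\ell(y,\cdot)$ is $L$-Lipschitz on $\mathbb{R}$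 for every $y$. Then for every $\delta\in(0,1)$, with probability at least $1-\delta$, the following holds simultaneously for all $A\in\mathcal{A}$: $$\mathbb{E}_{(x,y)\sim\mathcal{D}}\big[\ell(y,g_A(x))\big]\le\frac1N\sum_{n=1}^{N}\ell(y_n,g_A(x_n))+\frac{2^{3/2}L}{\sqrt N}\Big(2+\sqrt{\ln(DP+P+D)}\Big)+\sqrt{\frac{\ln(1/\delta)}{2N}}.$$ As a consequence, the number of partition candidates may grow sub-exponentially in $N$: if $D$, $L$, $\delta$ are fixed and $P=P_N$ satisfies $P_N=o(e^{cN})$ for every $c>0$, then the sum of the last two terms of the bound tends to $0$ as $N\to\infty$. -/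

import Mathlib

open MeasureTheory ProbabilityTheory Filter Topology Asymptotics
open scoped NNReal ENNReal

noncomputable section

namespace PartitionwiseLinear

variable {D P N : ℕ}

/-- The activeness vector `(f₀, f₁, …, f_P)`: the given activeness functions `f₁, …, f_P`
(indexed by `Fin P`), preceded by the global one `f₀`, which is constantly `1`. -/
def activeness (f : Fin P → (Fin D → ℝ) → ℝ) : Fin (P + 1) → (Fin D → ℝ) → ℝ :=
  Fin.cons (fun _ => 1) f

/-- The global and local residual predictor
`g(x) = a₀ᵀ x + ∑_{p=1}^P f_p(x) ∑_d a_{dp} x_d`, where the columns of the weight matrix `A`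
are `a₀, a₁, …, a_P`. -/
def predictor (f : Fin P → (Fin D → ℝ) → ℝ) (A : Matrix (Fin D) (Fin (P + 1)) ℝ)
    (x : Fin D → ℝ) : ℝ :=
  ∑ p, activeness f p x * ∑ d, A d p * x d

/-- The group regularizer, the sum of the norms of the restrictions of `A` to the `P` groups
`{(d, p) : d}` with `1 ≤ p ≤ P` (the local weight vectors) and to the `D (P + 1)` singleton
groups `{(d, p)}` with `0 ≤ p ≤ P`. Each restriction is measured in the `ℓ^q` norm: `q = 2` is
the group lasso with overlapping groups, `q = ∞` the regularizer with maximum norms. -/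
def groupReg (q : ℝ≥0∞) (A : Matrix (Fin D) (Fin (P + 1)) ℝ) : ℝ :=
  ∑ p : Fin P, ‖WithLp.toLp q (fun d => A d p.succ)‖ + ∑ p : Fin (P + 1), ∑ d, |A d p|

/-- The class of weights: the unit ball of the group regularizer. -/
def weightClass (D P : ℕ) (q : ℝ≥0∞) : Set (Matrix (Fin D) (Fin (P + 1)) ℝ) :=
  {A | groupReg q A ≤ 1}

/-- The expected loss of the predictor with weights `A` under the data distribution `μ`. -/
def expectedLoss {Y : Type*} [MeasurableSpace Y] (ℓ : Y → ℝ → ℝ)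
    (f : Fin P → (Fin D → ℝ) → ℝ) (μ : Measure ((Fin D → ℝ) × Y))
    (A : Matrix (Fin D) (Fin (P + 1)) ℝ) : ℝ :=
  ∫ z, ℓ z.2 (predictor f A z.1) ∂μ

/-- The empirical loss of the predictor with weights `A` on the sample `s`. -/
def empiricalLoss {Y : Type*} (ℓ : Y → ℝ → ℝ) (f : Fin P → (Fin D → ℝ) → ℝ)
    (s : Fin N → (Fin D → ℝ) × Y) (A : Matrix (Fin D) (Fin (P + 1)) ℝ) : ℝ :=
  1 / (N : ℝ) * ∑ n, ℓ (s n).2 (predictor f A (s n).1)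

/-- The complexity term `(2^{3/2} L / √N) (2 + √(ln (DP + P + D)))`. -/
def complexityTerm (L : ℝ) (D P N : ℕ) : ℝ :=
  (2 : ℝ) ^ (3 / 2 : ℝ) * L / √(N : ℝ) * (2 + √(Real.log ((D : ℝ) * P + P + D)))

/-- The confidence term `√(ln (1/δ) / (2N))`. -/
def confidenceTerm (δ : ℝ) (N : ℕ) : ℝ :=
  √(Real.log (1 / δ) / (2 * (N : ℝ)))

/-- A sequence of natural numbers grows sub-exponentially: it is `o(e^{cN})` for every `c > 0`. -/
def SubExponential (Q : ℕ → ℕ) : Prop :=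
  ∀ c : ℝ, 0 < c → (fun N : ℕ => (Q N : ℝ)) =o[atTop] (fun N : ℕ => Real.exp (c * (N : ℝ)))

end PartitionwiseLinear

end

/-! The predictor is linear in `A` with features `f_p(x) * x_d`, bounded by 1 almost surely, and the
regularizer dominates the entrywise ℓ¹ norm. On a sample, the prediction vectors therefore lie in
the absolutely convex hull of only `D (P + 1)` bounded vectors, so the number of weights enters the
Rademacher average through a logarithm (`signAverage_absConvex_le`). Contraction
(`signAverage_le_of_lipschitz`) passes from predictions to losses at the cost of `L`, symmetrization
(`integral_supDeviation_le`) bounds the expected largest deviation by twice the Rademacher average,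
and McDiarmid's inequality (`measure_ge_le_of_boundedDifferences`) adds the confidence term.

To keep suprema measurable, all this is done for finite families of weights
(`le_measure_forall_finite`). The bound does not depend on the size of the family, so continuity
from above extends it to a countable dense set of weights, and continuity of both losses in `A`
extends it to the whole class (`le_measure_forall_weightClass`).

For the limit, sub-exponential growth says that the logarithm is `o(N)`, which the factor `1 / √N`
beats. -/

namespace PartitionwiseLinear

/-! ### Rademacher averages: contraction and the finite class bound -/

/-- The average over all sign vectors `σ` of `⨆ i, ∑ n, σ n * u i n`; for `u i n = h i (x n)` this
is `N` times the empirical Rademacher complexity of the family `h` on the sample `x`. -/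
noncomputable def signAverage {ι : Type*} {N : ℕ} (u : ι → Fin N → ℝ) : ℝ :=
  (2 ^ N : ℝ)⁻¹ * ∑ σ : Fin N → ℤˣ, ⨆ i, ∑ n, ((σ n : ℤ) : ℝ) * u i n

theorem le_finite_iSup {ι : Type*} [Finite ι] (f : ι → ℝ) (i : ι) : f i ≤ ⨆ j, f j :=
  le_ciSup (Set.finite_range f).bddAbove i

theorem sum_units_int (F : ℤˣ → ℝ) : ∑ s, F s = F 1 + F (-1) := by
  rw [UnitsInt.univ, Finset.sum_pair (by decide)]

theorem sum_signs_succ {N : ℕ} (F : (Fin (N + 1) → ℤˣ) → ℝ) :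
    ∑ σ, F σ = ∑ τ : Fin N → ℤˣ, (F (Fin.cons 1 τ) + F (Fin.cons (-1) τ)) := by
  rw [← (Fin.consEquiv fun _ => ℤˣ).sum_comp, Fintype.sum_prod_type, sum_units_int,
    ← Finset.sum_add_distrib]
  rfl

theorem card_signs (N : ℕ) : Fintype.card (Fin N → ℤˣ) = 2 ^ N := by
  simp

/-- Contraction for a single sign. For any indices `i`, `j`, the left side contributes `c i + c j +
(a i - a j)`, at most `c i + c j + |b i - b j|`; the right side attains this after exchanging `i`
and `j` if `b i < b j`. -/
theorem iSup_add_iSup_sub_le {ι : Type*} [Finite ι] [Nonempty ι] (c a b : ι → ℝ)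
    (h : ∀ i j, |a i - a j| ≤ |b i - b j|) :
    (⨆ i, (c i + a i)) + ⨆ i, (c i - a i) ≤ (⨆ i, (c i + b i)) + ⨆ i, (c i - b i) := by
  rw [← le_sub_iff_add_le]
  refine ciSup_le fun i => ?_
  rw [le_sub_comm]
  refine ciSup_le fun j => ?_
  have h1 := (le_abs_self _).trans (h i j)
  have hi := le_finite_iSup (fun i => c i + b i) i
  have hj := le_finite_iSup (fun i => c i + b i) j
  have ki := le_finite_iSup (fun i => c i - b i) i
  have kj := le_finite_iSup (fun i => c i - b i) j
  rcases abs_cases (b i - b j) with ⟨h2, _⟩ | ⟨h2, _⟩ <;> rw [h2] at h1 <;> linarith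

/-- The signs are treated one at a time. The free offset `c` makes the induction work: it absorbs
the first coordinate while the others are replaced, and then absorbs the others while the first is
replaced. -/
theorem sum_iSup_signs_contraction {ι : Type*} [Finite ι] [Nonempty ι] {N : ℕ} (c : ι → ℝ)
    (u v : ι → Fin N → ℝ) (h : ∀ i j n, |u i n - u j n| ≤ |v i n - v j n|) :
    ∑ σ : Fin N → ℤˣ, (⨆ i, (c i + ∑ n, ((σ n : ℤ) : ℝ) * u i n)) ≤
      ∑ σ : Fin N → ℤˣ, ⨆ i, (c i + ∑ n, ((σ n : ℤ) : ℝ) * v i n) := by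
  induction N generalizing c with
  | zero => simp
  | succ N ih =>
    simp only [sum_signs_succ, Fin.sum_univ_succ, Fin.cons_zero, Fin.cons_succ,
      Units.val_one, Units.val_neg, Int.cast_one, Int.cast_neg, one_mul, neg_mul]
    calc
      _ = (∑ τ : Fin N → ℤˣ, ⨆ i, ((c i + u i 0) + ∑ n, ((τ n : ℤ) : ℝ) * u i n.succ)) +
          ∑ τ : Fin N → ℤˣ, ⨆ i, ((c i - u i 0) + ∑ n, ((τ n : ℤ) : ℝ) * u i n.succ) := by
        simp [Finset.sum_add_distrib, add_assoc, sub_eq_add_neg]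
      _ ≤ (∑ τ : Fin N → ℤˣ, ⨆ i, ((c i + u i 0) + ∑ n, ((τ n : ℤ) : ℝ) * v i n.succ)) +
          ∑ τ : Fin N → ℤˣ, ⨆ i, ((c i - u i 0) + ∑ n, ((τ n : ℤ) : ℝ) * v i n.succ) :=
        add_le_add (ih _ _ _ fun i j n => h i j n.succ) (ih _ _ _ fun i j n => h i j n.succ)
      _ ≤ _ := by
        rw [← Finset.sum_add_distrib]
        refine Finset.sum_le_sum fun τ _ => ?_
        convert iSup_add_iSup_sub_le (fun i => c i + ∑ n, ((τ n : ℤ) : ℝ) * v i n.succ)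
          (fun i => u i 0) (fun i => v i 0) (fun i j => h i j 0) using 4 <;> first | rfl | ring

theorem signAverage_le_of_lipschitz {ι : Type*} [Finite ι] [Nonempty ι] {N : ℕ}
    (u v : ι → Fin N → ℝ) (L : ℝ≥0) (h : ∀ i j n, |u i n - u j n| ≤ L * |v i n - v j n|) :
    signAverage u ≤ L * signAverage v := by
  have key := sum_iSup_signs_contraction 0 u (fun i n => L * v i n) fun i j n => by
    rw [← mul_sub, abs_mul, NNReal.abs_eq]
    exact h i j n
  simp only [Pi.zero_apply, zero_add] at key
  have hL : ∀ σ : Fin N → ℤˣ, (⨆ i, ∑ n, ((σ n : ℤ) : ℝ) * (L * v i n)) =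
      L * ⨆ i, ∑ n, ((σ n : ℤ) : ℝ) * v i n := fun σ => by
    rw [Real.mul_iSup_of_nonneg L.coe_nonneg]
    simp only [Finset.mul_sum, mul_left_comm]
  simp only [hL, ← Finset.mul_sum] at key
  rw [signAverage, signAverage, mul_left_comm]
  gcongr

/-- Independence of the signs factorizes the sum, and each factor is `2 * cosh (t * v n)`, at most
`2 * exp (t ^ 2 / 2)`. -/
theorem sum_signs_exp_le {N : ℕ} (v : Fin N → ℝ) (hv : ∀ n, |v n| ≤ 1) (t : ℝ) :
    ∑ σ : Fin N → ℤˣ, Real.exp (t * ∑ n, ((σ n : ℤ) : ℝ) * v n) ≤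
      2 ^ N * Real.exp (N * (t ^ 2 / 2)) := by
  calc
    _ = ∑ σ : Fin N → ℤˣ, ∏ n, Real.exp (t * (((σ n : ℤ) : ℝ) * v n)) := by
      simp_rw [← Real.exp_sum, Finset.mul_sum]
    _ = ∏ n, ∑ s : ℤˣ, Real.exp (t * (((s : ℤ) : ℝ) * v n)) := by
      rw [Finset.prod_univ_sum, Fintype.piFinset_univ]
    _ ≤ ∏ _n : Fin N, 2 * Real.exp (t ^ 2 / 2) := by
      refine Finset.prod_le_prod (fun _ _ => by positivity) fun n _ => ?_
      have h1 := Real.cosh_le_exp_half_sq (t * v n)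
      have h2 : Real.exp ((t * v n) ^ 2 / 2) ≤ Real.exp (t ^ 2 / 2) := by
        have : v n ^ 2 ≤ 1 := (sq_le_one_iff_abs_le_one _).2 (hv n)
        rw [mul_pow]
        gcongr
        exact mul_le_of_le_one_right (sq_nonneg t) this
      rw [Real.cosh_eq] at h1
      rw [sum_units_int]
      simp only [Units.val_one, Int.cast_one, one_mul, Units.val_neg, Int.cast_neg, neg_mul,
        mul_neg]
      linarith
    _ = _ := by
      rw [Finset.prod_const, Finset.card_univ, Fintype.card_fin, mul_pow, ← Real.exp_nat_mul]

/-- Massart's finite class bound for the absolutely convex hull of the vectors `v j`. -/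
theorem signAverage_absConvex_le {ι J : Type*} [Nonempty ι] [Fintype J] [Nonempty J]
    {N : ℕ} (hN : 0 < N) (v : J → Fin N → ℝ) (hv : ∀ j n, |v j n| ≤ 1) (w : ι → J → ℝ)
    (hw : ∀ i, ∑ j, |w i j| ≤ 1) :
    signAverage (fun i n => ∑ j, w i j * v j n) ≤
      √(2 * N * Real.log (2 * Fintype.card J)) := by
  set M : ℝ := (Fintype.card J : ℝ) with hM
  have hM1 : 1 ≤ M := by
    rw [hM]
    exact_mod_cast Fintype.card_pos (α := J)
  have hN' : (0 : ℝ) < N := by exact_mod_cast hN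
  set a := Real.log (2 * M) with ha_def
  have ha : 0 < a := Real.log_pos (by linarith)
  -- This is the minimizer of `a / t + N * t / 2`, the bound given by the exponential moment method.
  set t := √(2 * a / N) with ht_def
  have ht : 0 < t := Real.sqrt_pos.2 (by positivity)
  have ht2 : t ^ 2 = 2 * a / N := Real.sq_sqrt (by positivity)
  have hlog : 2 * a = t * √(2 * N * a) := by
    rw [ht_def, ← Real.sqrt_mul (by positivity),
      show 2 * a / N * (2 * N * a) = (2 * a) ^ 2 by field_simp, Real.sqrt_sq (by positivity)]
  let S : J → (Fin N → ℤˣ) → ℝ := fun j σ => ∑ n, ((σ n : ℤ) : ℝ) * v j n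
  have hcomb : ∀ i σ, ∑ n, ((σ n : ℤ) : ℝ) * ∑ j, w i j * v j n = ∑ j, w i j * S j σ := by
    intro i σ
    simp only [S, Finset.mul_sum]
    rw [Finset.sum_comm]
    simp only [mul_left_comm]
  -- The tangent inequality `y + 1 ≤ exp y` at `y = t * sup - 2 * a` takes the place of Jensen's
  -- inequality. The shift `2 * a` makes the average of the right side at most 1, which cancels the
  -- `+ 1`.
  have hpt : ∀ σ : Fin N → ℤˣ, t * (⨆ i, ∑ n, ((σ n : ℤ) : ℝ) * ∑ j, w i j * v j n) - 2 * a + 1 ≤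
      Real.exp (-(2 * a)) * ∑ j, (Real.exp (t * S j σ) + Real.exp (-t * S j σ)) := by
    intro σ
    -- A linear form on the ℓ¹ ball is bounded by its largest coefficient in absolute value. Both
    -- signs of it are kept, hence the 2 in `log (2 * M)`.
    obtain ⟨k, hk⟩ := Finite.exists_max fun j => |S j σ|
    have h1 : (⨆ i, ∑ n, ((σ n : ℤ) : ℝ) * ∑ j, w i j * v j n) ≤ |S k σ| := by
      refine ciSup_le fun i => ?_
      rw [hcomb]
      calc
        _ ≤ ∑ j, |w i j| * |S k σ| := Finset.sum_le_sum fun j _ =>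
          (le_abs_self _).trans (by
            rw [abs_mul]
            exact mul_le_mul_of_nonneg_left (hk j) (abs_nonneg _))
        _ ≤ _ := by
          rw [← Finset.sum_mul]
          exact mul_le_of_le_one_left (abs_nonneg _) (hw i)
    have h2 : Real.exp (t * |S k σ|) ≤ Real.exp (t * S k σ) + Real.exp (-t * S k σ) := by
      rcases abs_cases (S k σ) with ⟨h, _⟩ | ⟨h, _⟩ <;> rw [h]
      · linarith [Real.exp_pos (-t * S k σ)]
      · rw [mul_neg, ← neg_mul]
        linarith [Real.exp_pos (t * S k σ)]
    have h3 := Finset.single_le_sum (f := fun j => Real.exp (t * S j σ) + Real.exp (-t * S j σ))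
      (fun j _ => by positivity) (Finset.mem_univ k)
    calc
      _ ≤ -(2 * a) + t * |S k σ| + 1 := by
        linarith [mul_le_mul_of_nonneg_left h1 ht.le]
      _ ≤ Real.exp (-(2 * a)) * Real.exp (t * |S k σ|) := by
        rw [← Real.exp_add]
        exact Real.add_one_le_exp _
      _ ≤ _ := by
        gcongr
        exact h2.trans h3
  have hexp : ∑ σ : Fin N → ℤˣ, ∑ j, (Real.exp (t * S j σ) + Real.exp (-t * S j σ)) ≤
      2 ^ N * Real.exp (2 * a) := by
    rw [Finset.sum_comm]
    calc
      _ ≤ ∑ _j : J, 2 * (2 ^ N * Real.exp (N * (t ^ 2 / 2))) := by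
        refine Finset.sum_le_sum fun j _ => ?_
        rw [Finset.sum_add_distrib]
        have h1 := sum_signs_exp_le (v j) (hv j) t
        have h2 := sum_signs_exp_le (v j) (hv j) (-t)
        rw [neg_sq] at h2
        linarith
      _ = 2 ^ N * (Real.exp a * Real.exp a) := by
        rw [ht2, show (N : ℝ) * (2 * a / N / 2) = a by field_simp, Finset.sum_const,
          Finset.card_univ, nsmul_eq_mul, ← hM]
        nth_rw 2 [ha_def]
        rw [Real.exp_log (by linarith)]
        ring
      _ = _ := by rw [← Real.exp_add, two_mul]
  have hsum := Finset.sum_le_sum fun σ (_ : σ ∈ (Finset.univ : Finset (Fin N → ℤˣ))) => hpt σ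
  rw [← Finset.mul_sum, Finset.sum_add_distrib, Finset.sum_sub_distrib, ← Finset.mul_sum] at hsum
  simp only [Finset.sum_const, Finset.card_univ, card_signs, nsmul_eq_mul, mul_one] at hsum
  push_cast at hsum
  have h4 := mul_le_mul_of_nonneg_left hexp (Real.exp_nonneg (-(2 * a)))
  rw [mul_left_comm, ← Real.exp_add, neg_add_cancel, Real.exp_zero, mul_one] at h4
  have h5 : t * (∑ σ : Fin N → ℤˣ, ⨆ i, ∑ n, ((σ n : ℤ) : ℝ) * ∑ j, w i j * v j n) ≤
      t * (2 ^ N * √(2 * N * a)) := by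
    rw [mul_left_comm t, ← hlog]
    linarith
  rw [signAverage, inv_mul_le_iff₀ (by positivity)]
  exact le_of_mul_le_mul_left h5 ht

/-! ### Hoeffding's lemma and McDiarmid's inequality -/

section McDiarmid

variable {X : Type*} [MeasurableSpace X] (μ : Measure X) [IsProbabilityMeasure μ]

theorem integrable_of_abs_le {φ : X → ℝ} (hφ : Measurable φ) {K : ℝ} (hK : ∀ x, |φ x| ≤ K) :
    Integrable φ μ :=
  .of_bound hφ.aestronglyMeasurable K (ae_of_all _ hK)

theorem integrable_exp_of_abs_le {φ : X → ℝ} (hφ : Measurable φ) {K : ℝ} (hK : ∀ x, |φ x| ≤ K)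
    (t : ℝ) : Integrable (fun x => Real.exp (t * φ x)) μ := by
  refine .of_bound (hφ.const_mul t).exp.aestronglyMeasurable (Real.exp (|t| * K))
    (ae_of_all _ fun x => ?_)
  rw [Real.norm_eq_abs, Real.abs_exp]
  refine Real.exp_le_exp.2 ((le_abs_self _).trans ?_)
  rw [abs_mul]
  gcongr
  exact hK x

theorem abs_integral_le_of_abs_le {φ : X → ℝ} {K : ℝ} (hK : ∀ x, |φ x| ≤ K) :
    |∫ x, φ x ∂μ| ≤ K := by
  simpa using norm_integral_le_of_norm_le_const (μ := μ) (f := φ) (ae_of_all _ hK)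

/-- Hoeffding's lemma for a function of oscillation at most `c`. -/
theorem integral_exp_le_of_sub_le {φ : X → ℝ} (hφ : Measurable φ) {c : ℝ}
    (hc : ∀ x y, φ x - φ y ≤ c) (t : ℝ) :
    ∫ x, Real.exp (t * φ x) ∂μ ≤ Real.exp (t * ∫ x, φ x ∂μ) * Real.exp (t ^ 2 * c ^ 2 / 8) := by
  have : Nonempty X := nonempty_of_isProbabilityMeasure μ
  have hb : BddBelow (Set.range φ) := by
    inhabit X
    refine ⟨φ default - c, ?_⟩
    rintro _ ⟨x, rfl⟩
    linarith [hc default x]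
  have hmem : ∀ x, φ x ∈ Set.Icc (⨅ y, φ y) ((⨅ y, φ y) + c) := fun x =>
    ⟨ciInf_le hb x, by linarith [le_ciInf fun y => show φ x - c ≤ φ y by linarith [hc x y]]⟩
  have h := (hasSubgaussianMGF_of_mem_Icc (μ := μ) hφ.aemeasurable (ae_of_all _ hmem)).mgf_le t
  simp only [mgf, mul_sub, Real.exp_sub] at h
  rw [integral_div, div_le_iff₀ (Real.exp_pos _)] at h
  rw [mul_comm]
  refine h.trans_eq ?_
  congr 2
  rw [add_sub_cancel_left, NNReal.coe_pow, NNReal.coe_div, coe_nnnorm, Real.norm_eq_abs, div_pow,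
    sq_abs]
  simp only [NNReal.coe_ofNat]
  ring

theorem measurePreserving_cons (N : ℕ) :
    MeasurePreserving (fun z : X × (Fin N → X) => (Fin.cons z.1 z.2 : Fin (N + 1) → X))
      (μ.prod (Measure.pi fun _ => μ)) (Measure.pi fun _ => μ) := by
  have h := (measurePreserving_piFinSuccAbove (fun _ : Fin (N + 1) => μ) 0).symm
  convert h using 1
  ext z
  simp [MeasurableEquiv.piFinSuccAbove, Fin.insertNthEquiv]

/-- McDiarmid's inequality for the moment generating function. -/
theorem integral_exp_le_of_boundedDifferences {N : ℕ} {φ : (Fin N → X) → ℝ} (hφ : Measurable φ)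
    {K : ℝ} (hK : ∀ s, |φ s| ≤ K) {c : ℝ}
    (hc : ∀ n s s', (∀ m, m ≠ n → s m = s' m) → φ s - φ s' ≤ c) (t : ℝ) :
    ∫ s, Real.exp (t * φ s) ∂(Measure.pi fun _ => μ) ≤
      Real.exp (t * ∫ s, φ s ∂(Measure.pi fun _ => μ)) * Real.exp (N * (t ^ 2 * c ^ 2 / 8)) := by
  induction N with
  | zero => simp [Measure.pi_of_empty (fun _ : Fin 0 => μ) default]
  | succ N ih =>
    have hmp := measurePreserving_cons μ N
    have hmeas : Measurable fun z : X × (Fin N → X) => φ (Fin.cons z.1 z.2) :=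
      hφ.comp hmp.measurable
    -- Averaging out the first coordinate preserves the bounded differences, so the induction
    -- hypothesis applies to `ψ`; Hoeffding's lemma in that coordinate pays one factor.
    set ψ : (Fin N → X) → ℝ := fun s => ∫ x, φ (Fin.cons x s) ∂μ with hψ
    have hψm : Measurable ψ := hmeas.stronglyMeasurable.integral_prod_left.measurable
    have hψK : ∀ s, |ψ s| ≤ K := fun s => abs_integral_le_of_abs_le μ fun x => hK _
    have hsec : ∀ s : Fin N → X, Measurable fun x => φ (Fin.cons x s) := fun s =>
      hmeas.comp measurable_prodMk_right
    have hψc : ∀ n s s', (∀ m, m ≠ n → s m = s' m) → ψ s - ψ s' ≤ c := by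
      intro n s s' h
      rw [hψ]
      dsimp only
      rw [← integral_sub (integrable_of_abs_le μ (hsec s) fun _ => hK _)
        (integrable_of_abs_le μ (hsec s') fun _ => hK _)]
      calc
        _ ≤ ∫ _, c ∂μ := by
          refine integral_mono ((integrable_of_abs_le μ (hsec s) fun _ => hK _).sub
            (integrable_of_abs_le μ (hsec s') fun _ => hK _)) (integrable_const _) fun x => ?_
          refine hc n.succ _ _ fun m hm => ?_
          refine Fin.cases (fun _ => rfl) (fun m hm => ?_) m hm
          simpa using h m fun e => hm (e ▸ rfl)
        _ = c := by simp
    have hint : ∫ s, φ s ∂(Measure.pi fun _ => μ) = ∫ s, ψ s ∂(Measure.pi fun _ => μ) := by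
      rw [← hmp.map_eq, integral_map hmp.measurable.aemeasurable hφ.aestronglyMeasurable,
        integral_prod_symm _ (integrable_of_abs_le _ hmeas fun _ => hK _)]
    have hinte := integrable_exp_of_abs_le (μ.prod (Measure.pi fun _ : Fin N => μ)) hmeas
      (fun _ => hK _) t
    rw [hint]
    calc
      _ = ∫ s, ∫ x, Real.exp (t * φ (Fin.cons x s)) ∂μ ∂(Measure.pi fun _ : Fin N => μ) := by
        rw [← hmp.map_eq, integral_map hmp.measurable.aemeasurable
          (hφ.const_mul t).exp.aestronglyMeasurable, integral_prod_symm _ hinte]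
      _ ≤ ∫ s, Real.exp (t * ψ s) * Real.exp (t ^ 2 * c ^ 2 / 8)
          ∂(Measure.pi fun _ : Fin N => μ) := by
        refine integral_mono hinte.integral_prod_right
          ((integrable_exp_of_abs_le _ hψm hψK t).mul_const _) fun s => ?_
        refine integral_exp_le_of_sub_le μ (hsec s) (fun x y => ?_) t
        refine hc 0 _ _ fun m hm => ?_
        refine Fin.cases (fun h => absurd rfl h) (fun m _ => ?_) m hm
        simp
      _ ≤ _ := by
        rw [integral_mul_const]
        refine (mul_le_mul_of_nonneg_right (ih hψm hψK hψc) (Real.exp_nonneg _)).trans_eq ?_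
        rw [mul_assoc, ← Real.exp_add]
        push_cast
        ring_nf

/-- McDiarmid's inequality. -/
theorem measure_ge_le_of_boundedDifferences {N : ℕ} (hN : 0 < N) {φ : (Fin N → X) → ℝ}
    (hφ : Measurable φ) {K : ℝ} (hK : ∀ s, |φ s| ≤ K) {c : ℝ} (hc0 : 0 < c)
    (hc : ∀ n s s', (∀ m, m ≠ n → s m = s' m) → φ s - φ s' ≤ c) {ε : ℝ} (hε : 0 ≤ ε) :
    (Measure.pi fun _ => μ).real {s | (∫ s, φ s ∂(Measure.pi fun _ => μ)) + ε ≤ φ s} ≤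
      Real.exp (-(2 * ε ^ 2) / (N * c ^ 2)) := by
  have hN' : (0 : ℝ) < N := by exact_mod_cast hN
  -- The minimizer of `-t * ε + N * t ^ 2 * c ^ 2 / 8`.
  set t : ℝ := 4 * ε / (N * c ^ 2) with ht
  have ht0 : 0 ≤ t := by positivity
  set E := ∫ s, φ s ∂(Measure.pi fun _ => μ)
  refine (measure_ge_le_exp_mul_mgf (μ := Measure.pi fun _ : Fin N => μ) (X := φ) (E + ε) ht0
    (integrable_exp_of_abs_le _ hφ hK t)).trans ?_
  refine (mul_le_mul_of_nonneg_left (integral_exp_le_of_boundedDifferences μ hφ hK hc t)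
    (Real.exp_nonneg _)).trans_eq ?_
  rw [← Real.exp_add, ← Real.exp_add, ht]
  congr 1
  field_simp
  ring

end McDiarmid

/-! ### Symmetrization and concentration of the largest deviation -/

section Symmetrization

theorem abs_finite_iSup_le {ι : Type*} [Finite ι] [Nonempty ι] {f : ι → ℝ} {K : ℝ}
    (h : ∀ i, |f i| ≤ K) : |⨆ i, f i| ≤ K :=
  abs_le.2 ⟨((abs_le.1 (h (Classical.arbitrary ι))).1).trans (le_finite_iSup f _),
    ciSup_le fun i => (abs_le.1 (h i)).2⟩

theorem abs_sum_fin_le {N : ℕ} {a : Fin N → ℝ} {K : ℝ} (h : ∀ n, |a n| ≤ K) :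
    |∑ n, a n| ≤ N * K := by
  refine (Finset.abs_sum_le_sum_abs _ _).trans ((Finset.sum_le_sum fun n _ => h n).trans_eq ?_)
  simp

theorem abs_sign_mul (s : ℤˣ) (a : ℝ) : |((s : ℤ) : ℝ) * a| = |a| := by
  rcases Int.units_eq_one_or s with rfl | rfl <;> simp

theorem sum_signs_neg {N : ℕ} (F : (Fin N → ℤˣ) → ℝ) : ∑ σ, F (-σ) = ∑ σ, F σ :=
  Fintype.sum_equiv (Equiv.neg (Fin N → ℤˣ)) _ _ fun _ => rfl

variable {X : Type*} [MeasurableSpace X] (μ : Measure X)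

/-- Flipping the pairs of a double sample at the positions where `σ` is `-1` preserves its law. -/
theorem measurePreserving_swapSigns [IsProbabilityMeasure μ] {N : ℕ} (σ : Fin N → ℤˣ) :
    MeasurePreserving (fun (a : Fin N → X × X) n => if σ n = 1 then a n else (a n).swap)
      (Measure.pi fun _ => μ.prod μ) (Measure.pi fun _ => μ.prod μ) := by
  refine measurePreserving_pi (f := fun n (a : X × X) => if σ n = 1 then a else a.swap) _ _
    fun n => ?_
  by_cases h : σ n = 1
  · simp only [h, if_true]
    exact MeasurePreserving.id _
  · simpa only [h, if_false] using Measure.measurePreserving_swap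

/-- Swapping the pairs where `σ` is `-1` negates exactly those differences and leaves the law of the
double sample unchanged. -/
theorem integral_sum_sub_signs [IsProbabilityMeasure μ] {ι : Type*} [Finite ι] {N : ℕ} {h : ι → X → ℝ}
    (hm : ∀ i, Measurable (h i)) (σ : Fin N → ℤˣ) :
    ∫ z, ⨆ i, ∑ n, (h i (z.1 n) - h i (z.2 n))
        ∂((Measure.pi fun _ : Fin N => μ).prod (Measure.pi fun _ : Fin N => μ)) =
      ∫ z, ⨆ i, ∑ n, ((σ n : ℤ) : ℝ) * (h i (z.1 n) - h i (z.2 n))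
        ∂((Measure.pi fun _ : Fin N => μ).prod (Measure.pi fun _ : Fin N => μ)) := by
  have he := measurePreserving_arrowProdEquivProdArrow X X (Fin N) (fun _ => μ) (fun _ => μ)
  have hs := measurePreserving_swapSigns μ σ
  have hψ : ∀ σ : Fin N → ℤˣ, Measurable fun z : (Fin N → X) × (Fin N → X) =>
      ⨆ i, ∑ n, ((σ n : ℤ) : ℝ) * (h i (z.1 n) - h i (z.2 n)) := fun σ => by
    refine Measurable.iSup fun i => ?_
    have := hm i
    fun_prop
  have hψ1 := hψ 1
  simp only [Pi.one_apply, Units.val_one, Int.cast_one, one_mul] at hψ1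
  rw [← he.map_eq, integral_map he.measurable.aemeasurable hψ1.aestronglyMeasurable,
    integral_map he.measurable.aemeasurable (hψ σ).aestronglyMeasurable]
  conv_lhs => rw [← hs.map_eq]
  have hψe := (hψ1.comp he.measurable).aestronglyMeasurable
    (μ := Measure.map (fun (a : Fin N → X × X) n => if σ n = 1 then a n else (a n).swap)
      (Measure.pi fun _ => μ.prod μ))
  refine (integral_map hs.measurable.aemeasurable hψe).trans ?_
  refine integral_congr_ae (ae_of_all _ fun a => ?_)
  refine iSup_congr fun i => Finset.sum_congr rfl fun n _ => ?_
  rcases Int.units_eq_one_or (σ n) with h1 | h1 <;>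
    simp [h1, MeasurableEquiv.arrowProdEquivProdArrow, Equiv.arrowProdEquivProdArrow]

/-- The largest total deviation, over a family `h`, of the expectations from the values on a
sample. -/
noncomputable def supDeviation {ι : Type*} {N : ℕ} (h : ι → X → ℝ) (s : Fin N → X) : ℝ :=
  ⨆ i, ∑ n, ((∫ x, h i x ∂μ) - h i (s n))

variable {ι : Type*} {N : ℕ} {h : ι → X → ℝ}

theorem measurable_supDeviation [Finite ι] (hm : ∀ i, Measurable (h i)) :
    Measurable (supDeviation μ h : (Fin N → X) → ℝ) := by
  refine Measurable.iSup fun i => ?_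
  have := hm i
  fun_prop

theorem abs_integral_sub_le [IsProbabilityMeasure μ] (h01 : ∀ i x, h i x ∈ Set.Icc (0 : ℝ) 1) (i : ι) (x : X) :
    |(∫ x, h i x ∂μ) - h i x| ≤ 1 := by
  have h1 : 0 ≤ ∫ x, h i x ∂μ := integral_nonneg fun x => (h01 i x).1
  have h2 := (abs_le.1 (abs_integral_le_of_abs_le μ fun x =>
    abs_le.2 ⟨by linarith [(h01 i x).1], (h01 i x).2⟩)).2
  exact abs_le.2 ⟨by linarith [(h01 i x).2], by linarith [(h01 i x).1]⟩

theorem abs_supDeviation_le [IsProbabilityMeasure μ] [Finite ι] [Nonempty ι]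
    (h01 : ∀ i x, h i x ∈ Set.Icc (0 : ℝ) 1) (s : Fin N → X) :
    |supDeviation μ h s| ≤ N := by
  refine abs_finite_iSup_le fun i => ?_
  simpa using abs_sum_fin_le fun n => abs_integral_sub_le μ h01 i (s n)

/-- For each `i` the expectations cancel and only the `n`-th summand changes, by a difference of two
values in `[0, 1]`. -/
theorem supDeviation_sub_le [Finite ι] [Nonempty ι] (h01 : ∀ i x, h i x ∈ Set.Icc (0 : ℝ) 1) (n : Fin N)
    (s s' : Fin N → X) (hs : ∀ m, m ≠ n → s m = s' m) :
    supDeviation μ h s - supDeviation μ h s' ≤ 1 := by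
  rw [sub_le_iff_le_add]
  refine ciSup_le fun i => ?_
  have h1 : (∑ n, ((∫ x, h i x ∂μ) - h i (s' n))) ≤ supDeviation μ h s' :=
    le_finite_iSup (fun i => ∑ n, ((∫ x, h i x ∂μ) - h i (s' n))) i
  have h2 : (∑ n, ((∫ x, h i x ∂μ) - h i (s n))) - (∑ n, ((∫ x, h i x ∂μ) - h i (s' n))) =
      h i (s' n) - h i (s n) := by
    rw [← Finset.sum_sub_distrib, Finset.sum_eq_single n]
    · ring
    · intro m _ hmn
      simp [hs m hmn]
    · simp
  linarith [(h01 i (s n)).1, (h01 i (s' n)).2]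

/-- Symmetrization. -/
theorem integral_supDeviation_le [IsProbabilityMeasure μ] [Finite ι] [Nonempty ι]
    (hm : ∀ i, Measurable (h i))
    (h01 : ∀ i x, h i x ∈ Set.Icc (0 : ℝ) 1) :
    ∫ s, supDeviation μ h s ∂(Measure.pi fun _ : Fin N => μ) ≤
      2 * ∫ s, signAverage (fun i n => h i (s n)) ∂(Measure.pi fun _ : Fin N => μ) := by
  set π := Measure.pi fun _ : Fin N => μ with hπ
  have habs : ∀ i x, |h i x| ≤ 1 := fun i x =>
    abs_le.2 ⟨by linarith [(h01 i x).1], (h01 i x).2⟩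
  have habs2 : ∀ i x y, |h i x - h i y| ≤ 1 := fun i x y =>
    abs_le.2 ⟨by linarith [(h01 i x).1, (h01 i y).2], by linarith [(h01 i y).1, (h01 i x).2]⟩
  let A : (Fin N → ℤˣ) → (Fin N → X) → ℝ := fun σ s => ⨆ i, ∑ n, ((σ n : ℤ) : ℝ) * h i (s n)
  have hAm : ∀ σ, Measurable (A σ) := fun σ => by
    refine Measurable.iSup fun i => ?_
    have := hm i
    fun_prop
  have hAK : ∀ σ s, |A σ s| ≤ N * 1 := fun σ s =>
    abs_finite_iSup_le fun i => abs_sum_fin_le fun n => by rw [abs_sign_mul]; exact habs _ _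
  have hAi : ∀ σ, Integrable (A σ) π := fun σ => integrable_of_abs_le π (hAm σ) (hAK σ)
  let B : (Fin N → ℤˣ) → (Fin N → X) × (Fin N → X) → ℝ := fun σ z =>
    ⨆ i, ∑ n, ((σ n : ℤ) : ℝ) * (h i (z.1 n) - h i (z.2 n))
  have hBm : ∀ σ, Measurable (B σ) := fun σ => by
    refine Measurable.iSup fun i => ?_
    have := hm i
    fun_prop
  have hBK : ∀ σ z, |B σ z| ≤ N * 1 := fun σ s =>
    abs_finite_iSup_le fun i => abs_sum_fin_le fun n => by rw [abs_sign_mul]; exact habs2 _ _ _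
  have hBi : ∀ σ, Integrable (B σ) (π.prod π) := fun σ =>
    integrable_of_abs_le _ (hBm σ) (hBK σ)
  -- Each expectation is an average over an independent ghost sample, and the supremum of integrals
  -- is at most the integral of the supremum.
  have hghost : ∀ s, supDeviation μ h s ≤ ∫ s', B 1 (s', s) ∂π := by
    intro s
    refine ciSup_le fun i => ?_
    have hev : ∀ n, Integrable (fun s' : Fin N → X => h i (s' n) - h i (s n)) π := fun n =>
      integrable_of_abs_le π (((hm i).comp (measurable_pi_apply n)).sub_const _)
        fun _ => habs2 _ _ _
    have h1 : ∑ n, ((∫ x, h i x ∂μ) - h i (s n)) =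
        ∫ s', ∑ n, (h i (s' n) - h i (s n)) ∂π := by
      rw [integral_finsetSum _ fun n _ => hev n]
      refine Finset.sum_congr rfl fun n _ => ?_
      have hp := measurePreserving_eval (fun _ : Fin N => μ) n
      have hin : Integrable (fun s' : Fin N → X => h i (s' n)) π :=
        integrable_of_abs_le π ((hm i).comp (measurable_pi_apply n)) fun _ => habs _ _
      rw [integral_sub hin (integrable_const _)]
      simp only [integral_const, probReal_univ, one_smul]
      rw [← hp.map_eq, integral_map hp.measurable.aemeasurable (hm i).aestronglyMeasurable]
    rw [h1]
    refine integral_mono (integrable_finsetSum _ fun n _ => hev n)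
      (integrable_of_abs_le π ((hBm 1).comp measurable_prodMk_right) fun _ => hBK _ _) fun s' => ?_
    simpa [B] using le_finite_iSup (fun i => ∑ n, (h i (s' n) - h i (s n))) i
  have hB1 : ∀ σ, ∫ z, B 1 z ∂(π.prod π) = ∫ z, B σ z ∂(π.prod π) := fun σ => by
    have := integral_sum_sub_signs μ hm σ
    simpa [B] using this
  -- The supremum is subadditive. The ghost and original halves carry opposite signs, which no
  -- longer matters after summing over all `σ`.
  have hBA : ∀ σ, ∫ z, B σ z ∂(π.prod π) ≤ (∫ s, A σ s ∂π) + ∫ s, A (-σ) s ∂π := by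
    intro σ
    have h1 : ∫ z, A σ z.1 ∂(π.prod π) = ∫ s, A σ s ∂π := by
      simpa using integral_fun_fst (μ := π) (ν := π) (A σ)
    have h2 : ∫ z, A (-σ) z.2 ∂(π.prod π) = ∫ s, A (-σ) s ∂π := by
      simpa using integral_fun_snd (μ := π) (ν := π) (A (-σ))
    rw [← h1, ← h2, ← integral_add ((hAi σ).comp_fst π) ((hAi (-σ)).comp_snd π)]
    refine integral_mono (hBi σ) (((hAi σ).comp_fst π).add ((hAi (-σ)).comp_snd π)) fun z => ?_
    refine ciSup_le fun i => ?_
    have h3 := le_finite_iSup (fun i => ∑ n, ((σ n : ℤ) : ℝ) * h i (z.1 n)) i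
    have h4 := le_finite_iSup (fun i => ∑ n, (((-σ) n : ℤ) : ℝ) * h i (z.2 n)) i
    refine Eq.trans_le ?_ (add_le_add h3 h4)
    rw [← Finset.sum_add_distrib]
    refine Finset.sum_congr rfl fun n _ => ?_
    simp only [Pi.neg_apply, Units.val_neg, Int.cast_neg]
    ring
  have hsum : (2 ^ N : ℝ) * ∫ z, B 1 z ∂(π.prod π) ≤ 2 * ∑ σ, ∫ s, A σ s ∂π := by
    calc
      _ = ∑ _σ : Fin N → ℤˣ, ∫ z, B 1 z ∂(π.prod π) := by
        rw [Finset.sum_const, Finset.card_univ, card_signs, nsmul_eq_mul]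
        push_cast
        rfl
      _ ≤ ∑ σ : Fin N → ℤˣ, ((∫ s, A σ s ∂π) + ∫ s, A (-σ) s ∂π) :=
        Finset.sum_le_sum fun σ _ => (hB1 σ).trans_le (hBA σ)
      _ = _ := by
        rw [Finset.sum_add_distrib, sum_signs_neg fun σ => ∫ s, A σ s ∂π]
        ring
  calc
    _ ≤ ∫ s, ∫ s', B 1 (s', s) ∂π ∂π :=
      integral_mono (integrable_of_abs_le π (measurable_supDeviation μ hm)
        (abs_supDeviation_le μ h01)) (hBi 1).integral_prod_right hghost
    _ = ∫ z, B 1 z ∂(π.prod π) := (integral_prod_symm _ (hBi 1)).symm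
    _ ≤ 2 * ((2 ^ N : ℝ)⁻¹ * ∑ σ, ∫ s, A σ s ∂π) := by
      rw [mul_left_comm, ← div_eq_inv_mul, le_div_iff₀ (by positivity), mul_comm]
      exact hsum
    _ = _ := by
      rw [← integral_finsetSum _ fun σ _ => hAi σ, ← integral_const_mul]
      rfl

theorem measure_supDeviation_ge_le [IsProbabilityMeasure μ] [Finite ι] [Nonempty ι]
    (hN : 0 < N) (hm : ∀ i, Measurable (h i))
    (h01 : ∀ i x, h i x ∈ Set.Icc (0 : ℝ) 1) {R : ℝ}
    (hR : ∀ᵐ s ∂(Measure.pi fun _ : Fin N => μ), signAverage (fun i n => h i (s n)) ≤ R)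
    {ε : ℝ} (hε : 0 ≤ ε) :
    (Measure.pi fun _ : Fin N => μ).real {s | 2 * R + ε ≤ supDeviation μ h s} ≤
      Real.exp (-(2 * ε ^ 2) / N) := by
  have hmR : Integrable (fun s : Fin N → X => signAverage fun i n => h i (s n))
      (Measure.pi fun _ : Fin N => μ) := by
    refine (integrable_finsetSum _ fun σ _ => ?_).const_mul _
    refine integrable_of_abs_le _ (K := N * 1) (Measurable.iSup fun i => ?_) fun s => ?_
    · have := hm i
      fun_prop
    · refine abs_finite_iSup_le fun i => abs_sum_fin_le fun n => ?_
      rw [abs_sign_mul]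
      exact abs_le.2 ⟨by linarith [(h01 i (s n)).1], (h01 i (s n)).2⟩
  have hE : ∫ s, supDeviation μ h s ∂(Measure.pi fun _ : Fin N => μ) ≤ 2 * R := by
    refine (integral_supDeviation_le μ hm h01).trans ?_
    have := integral_mono_ae hmR (integrable_const R) hR
    simp only [integral_const, probReal_univ, one_smul] at this
    linarith
  refine (measureReal_mono fun s (hs : 2 * R + ε ≤ supDeviation μ h s) => ?_).trans
    ((measure_ge_le_of_boundedDifferences μ hN (measurable_supDeviation μ hm)
      (abs_supDeviation_le μ h01) one_pos (supDeviation_sub_le μ h01) hε).trans_eq ?_)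
  · exact (add_le_add_left hE ε).trans hs
  · rw [one_pow, mul_one]

end Symmetrization

/-! ### The predictor as a combination of bounded features -/

section Predictor

variable {D P : ℕ} {f : Fin P → (Fin D → ℝ) → ℝ}

theorem measurable_activeness (hf : ∀ p, Measurable (f p)) (p : Fin (P + 1)) :
    Measurable (activeness f p) := by
  refine Fin.cases ?_ (fun p => ?_) p
  · exact measurable_const
  · exact hf p

theorem abs_activeness_le (hf01 : ∀ p x, f p x = 0 ∨ f p x = 1) (p : Fin (P + 1))
    (x : Fin D → ℝ) : |activeness f p x| ≤ 1 := by
  refine Fin.cases ?_ (fun p => ?_) p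
  · simp [activeness]
  · rcases hf01 p x with h | h <;> simp [activeness, h]

theorem measurable_predictor (hf : ∀ p, Measurable (f p)) (A : Matrix (Fin D) (Fin (P + 1)) ℝ) :
    Measurable (predictor f A) := by
  have := measurable_activeness hf
  unfold predictor
  fun_prop

theorem continuous_predictor (x : Fin D → ℝ) : Continuous fun A => predictor f A x := by
  unfold predictor
  fun_prop

theorem predictor_eq_sum_prod (A : Matrix (Fin D) (Fin (P + 1)) ℝ) (x : Fin D → ℝ) :
    predictor f A x =
      ∑ j : Fin (P + 1) × Fin D, A j.2 j.1 * (activeness f j.1 x * x j.2) := by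
  rw [Fintype.sum_prod_type]
  simp only [predictor, Finset.mul_sum, mul_left_comm]

theorem sum_abs_le_one_of_mem_weightClass {q : ℝ≥0∞} [Fact (1 ≤ q)]
    {A : Matrix (Fin D) (Fin (P + 1)) ℝ} (hA : A ∈ weightClass D P q) :
    ∑ j : Fin (P + 1) × Fin D, |A j.2 j.1| ≤ 1 := by
  have h : groupReg q A ≤ 1 := hA
  rw [groupReg] at h
  rw [Fintype.sum_prod_type]
  have : 0 ≤ ∑ p : Fin P, ‖WithLp.toLp q (fun d => A d p.succ)‖ :=
    Finset.sum_nonneg fun _ _ => norm_nonneg _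
  linarith

theorem zero_mem_weightClass (q : ℝ≥0∞) [Fact (1 ≤ q)] : 0 ∈ weightClass D P q := by
  have h : (fun _ : Fin D => (0 : ℝ)) = 0 := rfl
  simp [weightClass, groupReg, h]

end Predictor

/-- The numerical comparison between the finite class bound for the `2 D (P + 1)` signed features
and the complexity term. -/
theorem two_mul_massart_le_complexityTerm {D P N : ℕ} (hD : 0 < D) (hN : 0 < N) (L : ℝ≥0) :
    2 * (L * √(2 * N * Real.log (2 * ((P + 1) * D)))) ≤ N * complexityTerm L D P N := by
  have hN' : (0 : ℝ) < N := by exact_mod_cast hN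
  have hD' : (1 : ℝ) ≤ D := by exact_mod_cast hD
  have hP : (0 : ℝ) ≤ P := P.cast_nonneg
  have hDP : (0 : ℝ) ≤ D * P := by positivity
  have h2 : (2 : ℝ) ^ (3 / 2 : ℝ) = 2 * √2 := by
    rw [show (3 / 2 : ℝ) = 1 + 1 / 2 by norm_num, Real.rpow_add two_pos, Real.rpow_one,
      Real.sqrt_eq_rpow]
  have hlog : √(Real.log (2 * ((P + 1) * D))) ≤ 2 + √(Real.log ((D : ℝ) * P + P + D)) := by
    -- Here `(P + 1) * D = D * P + D`; the extra `P` in the stated bound is slack.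
    have hmono : Real.log ((P + 1) * D) ≤ Real.log ((D : ℝ) * P + P + D) :=
      Real.log_le_log (by positivity) (by linarith)
    -- With this, `√(log 2 + b) ≤ 2 + √b`, so the additive 2 pays for the doubling by signs.
    have hl2 : Real.log 2 ≤ 2 ^ 2 := by linarith [Real.log_two_lt_d9]
    have hpos : 0 ≤ Real.log ((D : ℝ) * P + P + D) := Real.log_nonneg (by linarith)
    rw [Real.log_mul two_ne_zero (by positivity), Real.sqrt_le_left (by positivity)]
    nlinarith [Real.sq_sqrt hpos, Real.sqrt_nonneg (Real.log ((D : ℝ) * P + P + D))]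
  rw [complexityTerm, h2, Real.sqrt_mul (by positivity), Real.sqrt_mul zero_le_two]
  have hs : (N : ℝ) * (2 * √2 * L / √N) = 2 * √2 * L * √N := by
    rw [mul_div_assoc', mul_comm, mul_div_assoc, Real.div_sqrt]
  rw [← mul_assoc (N : ℝ), hs]
  calc
    _ = 2 * √2 * L * √N * √(Real.log (2 * ((P + 1) * D))) := by ring
    _ ≤ _ := by gcongr

/-! ### The uniform bound: finite families, then the whole class -/

section Deviation

variable {Y : Type*} [MeasurableSpace Y] {D P N : ℕ} {f : Fin P → (Fin D → ℝ) → ℝ}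
  {ℓ : Y → ℝ → ℝ} {L : ℝ≥0} {q : ℝ≥0∞} {δ : ℝ}

theorem measurable_loss_predictor (hf : ∀ p, Measurable (f p))
    (hℓ : Measurable (Function.uncurry ℓ)) (A : Matrix (Fin D) (Fin (P + 1)) ℝ) :
    Measurable fun z : (Fin D → ℝ) × Y => ℓ z.2 (predictor f A z.1) :=
  hℓ.comp (measurable_snd.prodMk ((measurable_predictor hf A).comp measurable_fst))

theorem signAverage_loss_le {Y : Type*} {ℓ : Y → ℝ → ℝ} (hD : 0 < D) (hN : 0 < N) [Fact (1 ≤ q)]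
    (hf01 : ∀ p x, f p x = 0 ∨ f p x = 1) (hL : ∀ y, LipschitzWith L (ℓ y))
    {ι : Type*} [Finite ι] [Nonempty ι] {A : ι → Matrix (Fin D) (Fin (P + 1)) ℝ}
    (hA : ∀ i, A i ∈ weightClass D P q) {s : Fin N → (Fin D → ℝ) × Y}
    (hs : ∀ n, ‖(s n).1‖ ≤ 1) :
    signAverage (fun i n => ℓ (s n).2 (predictor f (A i) (s n).1)) ≤
      L * √(2 * N * Real.log (2 * ((P + 1) * D))) := by
  have : Nonempty (Fin (P + 1) × Fin D) := ⟨0, ⟨0, hD⟩⟩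
  have hlip : ∀ i j n, |ℓ (s n).2 (predictor f (A i) (s n).1) -
      ℓ (s n).2 (predictor f (A j) (s n).1)| ≤
      L * |predictor f (A i) (s n).1 - predictor f (A j) (s n).1| := fun i j n => by
    simpa only [Real.dist_eq] using (hL (s n).2).dist_le_mul (predictor f (A i) (s n).1) _
  refine (signAverage_le_of_lipschitz _ (fun i n => predictor f (A i) (s n).1) L hlip).trans ?_
  refine mul_le_mul_of_nonneg_left ?_ L.coe_nonneg
  simp only [predictor_eq_sum_prod]
  have h := signAverage_absConvex_le hN
    (fun (j : Fin (P + 1) × Fin D) n => activeness f j.1 (s n).1 * (s n).1 j.2) (fun j n => ?_)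
    (fun i j => A i j.2 j.1) fun i => sum_abs_le_one_of_mem_weightClass (hA i)
  · simpa using h
  · rw [abs_mul]
    exact mul_le_one₀ (abs_activeness_le hf01 _ _) (abs_nonneg _)
      ((norm_le_pi_norm (s n).1 j.2).trans (hs n))

/-- The set of samples on which the generalization bound holds for the weights `A`. -/
def goodSamples (ℓ : Y → ℝ → ℝ) (f : Fin P → (Fin D → ℝ) → ℝ) (μ : Measure ((Fin D → ℝ) × Y))
    (L : ℝ≥0) (δ : ℝ) (N : ℕ) (A : Matrix (Fin D) (Fin (P + 1)) ℝ) :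
    Set (Fin N → (Fin D → ℝ) × Y) :=
  {s | expectedLoss ℓ f μ A ≤
    empiricalLoss ℓ f s A + complexityTerm L D P N + confidenceTerm δ N}

variable (μ : Measure ((Fin D → ℝ) × Y))

theorem measurableSet_goodSamples (hf : ∀ p, Measurable (f p))
    (hℓ : Measurable (Function.uncurry ℓ)) (A : Matrix (Fin D) (Fin (P + 1)) ℝ) :
    MeasurableSet (goodSamples ℓ f μ L δ N A) := by
  refine measurableSet_le measurable_const ?_
  have h : ∀ n, Measurable fun s : Fin N → (Fin D → ℝ) × Y =>
      ℓ (s n).2 (predictor f A (s n).1) := fun n =>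
    (measurable_loss_predictor hf hℓ A).comp (measurable_pi_apply n)
  unfold empiricalLoss
  exact (((Finset.measurable_sum _ fun n _ => h n).const_mul _).add_const _).add_const _

theorem le_measure_forall_finite [IsProbabilityMeasure μ] (hD : 0 < D) (hN : 0 < N)
    [Fact (1 ≤ q)] (hf : ∀ p, Measurable (f p)) (hf01 : ∀ p x, f p x = 0 ∨ f p x = 1)
    (hℓ : Measurable (Function.uncurry ℓ)) (hL : ∀ y, LipschitzWith L (ℓ y))
    (hℓ01 : ∀ y t, ℓ y t ∈ Set.Icc (0 : ℝ) 1) (hμ : ∀ᵐ z ∂μ, ‖z.1‖ ≤ 1)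
    (hδ0 : 0 < δ) (hδ1 : δ < 1) {ι : Type*} [Finite ι] [Nonempty ι]
    {A : ι → Matrix (Fin D) (Fin (P + 1)) ℝ} (hA : ∀ i, A i ∈ weightClass D P q) :
    ENNReal.ofReal (1 - δ) ≤
      (Measure.pi fun _ : Fin N => μ) (⋂ i, goodSamples ℓ f μ L δ N (A i)) := by
  have hN' : (0 : ℝ) < N := by exact_mod_cast hN
  set h : ι → (Fin D → ℝ) × Y → ℝ := fun i z => ℓ z.2 (predictor f (A i) z.1) with hh
  set R : ℝ := L * √(2 * N * Real.log (2 * ((P + 1) * D)))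
  have hR : ∀ᵐ s ∂(Measure.pi fun _ : Fin N => μ), signAverage (fun i n => h i (s n)) ≤ R := by
    have : ∀ᵐ s ∂(Measure.pi fun _ : Fin N => μ), ∀ n, ‖(s n).1‖ ≤ 1 :=
      eventually_all.2 fun n =>
        (Measure.tendsto_eval_ae_ae (μ := fun _ : Fin N => μ) (i := n)).eventually hμ
    filter_upwards [this] with s hs
    exact signAverage_loss_le hD hN hf01 hL hA hs
  have hconf : 0 ≤ confidenceTerm δ N := Real.sqrt_nonneg _
  -- The deviation is a sum, not a mean, so the confidence term is scaled by `N`.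
  have hbad := measure_supDeviation_ge_le μ hN (fun i => measurable_loss_predictor hf hℓ (A i))
    (fun i z => hℓ01 _ _) hR (mul_nonneg hN'.le hconf)
  have hexp : Real.exp (-(2 * (N * confidenceTerm δ N) ^ 2) / N) = δ := by
    have hlog : 0 ≤ Real.log (1 / δ) := Real.log_nonneg (by rw [le_div_iff₀ hδ0]; linarith)
    rw [mul_pow, confidenceTerm, Real.sq_sqrt (by positivity),
      show -(2 * ((N : ℝ) ^ 2 * (Real.log (1 / δ) / (2 * N)))) / N = -Real.log (1 / δ) by
        field_simp]
    rw [one_div, Real.log_inv, neg_neg, Real.exp_log hδ0]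
  rw [hexp] at hbad
  set bad : Set (Fin N → (Fin D → ℝ) × Y) :=
    {s | 2 * R + N * confidenceTerm δ N ≤ supDeviation μ h s}
  have hcover : Set.univ ⊆ bad ∪ ⋂ i, goodSamples ℓ f μ L δ N (A i) := by
    intro s _
    by_cases hs : s ∈ bad
    · exact Or.inl hs
    refine Or.inr (Set.mem_iInter.2 fun i => ?_)
    have hs' : supDeviation μ h s < 2 * R + N * confidenceTerm δ N := not_le.1 hs
    have h1 : ∑ n, ((∫ x, h i x ∂μ) - h i (s n)) ≤ supDeviation μ h s :=
      le_finite_iSup (fun i => ∑ n, ((∫ x, h i x ∂μ) - h i (s n))) i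
    have h2 : ∑ n, ((∫ x, h i x ∂μ) - h i (s n)) =
        N * (expectedLoss ℓ f μ (A i) - empiricalLoss ℓ f s (A i)) := by
      rw [Finset.sum_sub_distrib, mul_sub, empiricalLoss, ← mul_assoc, mul_one_div_cancel hN'.ne']
      simp [hh, expectedLoss]
    have h3 := two_mul_massart_le_complexityTerm (P := P) hD hN L
    have h4 : N * (expectedLoss ℓ f μ (A i) - empiricalLoss ℓ f s (A i)) ≤
        N * (complexityTerm L D P N + confidenceTerm δ N) := by
      rw [mul_add]
      linarith
    have h5 := le_of_mul_le_mul_left h4 hN'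
    rw [goodSamples, Set.mem_ofPred_eq]
    linarith
  have hone := (measure_mono (μ := Measure.pi fun _ : Fin N => μ) hcover).trans
    (measure_union_le _ _)
  rw [measure_univ] at hone
  have hbad' : (Measure.pi fun _ : Fin N => μ) bad ≤ ENNReal.ofReal δ :=
    (ENNReal.le_ofReal_iff_toReal_le (measure_ne_top _ _) hδ0.le).2 hbad
  rw [ENNReal.ofReal_sub _ hδ0.le, ENNReal.ofReal_one]
  refine tsub_le_iff_left.2 (hone.trans ?_)
  gcongr

theorem continuous_expectedLoss [IsProbabilityMeasure μ] (hf : ∀ p, Measurable (f p))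
    (hℓ : Measurable (Function.uncurry ℓ)) (hL : ∀ y, LipschitzWith L (ℓ y))
    (hℓ01 : ∀ y t, ℓ y t ∈ Set.Icc (0 : ℝ) 1) : Continuous (expectedLoss ℓ f μ) := by
  have : FirstCountableTopology (Matrix (Fin D) (Fin (P + 1)) ℝ) :=
    inferInstanceAs (FirstCountableTopology (Fin D → Fin (P + 1) → ℝ))
  refine continuous_of_dominated (bound := fun _ => 1)
    (fun A => (measurable_loss_predictor hf hℓ A).aestronglyMeasurable)
    (fun A => ae_of_all _ fun z => ?_) (integrable_const _)
    (ae_of_all _ fun z => (hL _).continuous.comp (continuous_predictor _))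
  rw [Real.norm_eq_abs, abs_of_nonneg (hℓ01 _ _).1]
  exact (hℓ01 _ _).2

theorem continuous_empiricalLoss {Y : Type*} {ℓ : Y → ℝ → ℝ} (hL : ∀ y, LipschitzWith L (ℓ y))
    (s : Fin N → (Fin D → ℝ) × Y) : Continuous (empiricalLoss ℓ f s) := by
  unfold empiricalLoss
  exact continuous_const.mul
    (continuous_finsetSum _ fun n _ => (hL _).continuous.comp (continuous_predictor _))

theorem le_measure_forall_weightClass [IsProbabilityMeasure μ] (hD : 0 < D) (hN : 0 < N)
    [Fact (1 ≤ q)] (hf : ∀ p, Measurable (f p)) (hf01 : ∀ p x, f p x = 0 ∨ f p x = 1)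
    (hℓ : Measurable (Function.uncurry ℓ)) (hL : ∀ y, LipschitzWith L (ℓ y))
    (hℓ01 : ∀ y t, ℓ y t ∈ Set.Icc (0 : ℝ) 1) (hμ : ∀ᵐ z ∂μ, ‖z.1‖ ≤ 1)
    (hδ0 : 0 < δ) (hδ1 : δ < 1) :
    ∃ G : Set (Fin N → (Fin D → ℝ) × Y), MeasurableSet G ∧
      ENNReal.ofReal (1 - δ) ≤ (Measure.pi fun _ : Fin N => μ) G ∧
      ∀ s ∈ G, ∀ A ∈ weightClass D P q, s ∈ goodSamples ℓ f μ L δ N A := by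
  have : Nonempty (weightClass D P q) := ⟨⟨0, zero_mem_weightClass q⟩⟩
  have : SecondCountableTopology (Matrix (Fin D) (Fin (P + 1)) ℝ) :=
    inferInstanceAs (SecondCountableTopology (Fin D → Fin (P + 1) → ℝ))
  let A : ℕ → weightClass D P q := TopologicalSpace.denseSeq _
  have hmeas : ∀ k, MeasurableSet (goodSamples ℓ f μ L δ N (A k).1) := fun k =>
    measurableSet_goodSamples μ hf hℓ _
  -- The range `Fin (n + 1)` keeps each finite family nonempty.
  let E : ℕ → Set (Fin N → (Fin D → ℝ) × Y) := fun n =>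
    ⋂ k : Fin (n + 1), goodSamples ℓ f μ L δ N (A k).1
  have hE : ∀ n, MeasurableSet (E n) := fun n => MeasurableSet.iInter fun k => hmeas _
  have hEanti : Antitone E := fun m n hmn s hs => Set.mem_iInter.2 fun k =>
    Set.mem_iInter.1 hs ⟨k, by omega⟩
  refine ⟨⋂ n, E n, MeasurableSet.iInter hE, ?_, fun s hs => ?_⟩
  · exact ge_of_tendsto' (tendsto_measure_iInter_atTop (fun n => (hE n).nullMeasurableSet) hEanti
      ⟨0, measure_ne_top _ _⟩) fun n => le_measure_forall_finite μ hD hN hf hf01 hℓ hL hℓ01 hμ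
        hδ0 hδ1 fun k => (A k).2
  · have hcl : IsClosed {B : weightClass D P q | s ∈ goodSamples ℓ f μ L δ N B.1} :=
      isClosed_le ((continuous_expectedLoss μ hf hℓ hL hℓ01).comp continuous_subtype_val)
        ((((continuous_empiricalLoss hL s).comp continuous_subtype_val).add continuous_const).add
          continuous_const)
    have hall := (TopologicalSpace.denseRange_denseSeq (weightClass D P q)).closure_range ▸
      closure_minimal (s := Set.range A) (by
        rintro _ ⟨k, rfl⟩
        exact Set.mem_iInter.1 (Set.mem_iInter.1 hs k) (Fin.last k)) hcl
    exact fun B hB => hall (Set.mem_univ (⟨B, hB⟩ : weightClass D P q))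

end Deviation

/-! ### Asymptotics under sub-exponential growth -/

theorem tendsto_log_div_of_subExponential {Q : ℕ → ℕ} (hQ : SubExponential Q) {D : ℕ}
    (hD : 0 < D) :
    Tendsto (fun n : ℕ => Real.log ((D : ℝ) * Q n + Q n + D) / n) atTop (𝓝 0) := by
  have hD' : (1 : ℝ) ≤ D := by exact_mod_cast hD
  have hlog : ∀ n, 0 ≤ Real.log ((D : ℝ) * Q n + Q n + D) := fun n =>
    Real.log_nonneg (le_add_of_nonneg_of_le (by positivity) hD')
  -- This form asks only for `n > n₀`, which makes `n` positive for the division.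
  rw [Metric.tendsto_atTop']
  intro ε hε
  have hexp : Tendsto (fun n : ℕ => Real.exp (ε / 2 * n)) atTop atTop :=
    Real.tendsto_exp_atTop.comp
      (tendsto_natCast_atTop_atTop.const_mul_atTop (half_pos hε))
  -- The rate `ε / 2` gives `log ≤ ε / 2 * n` eventually, strictly below `ε * n`.
  have ho : (fun n : ℕ => (D : ℝ) * Q n + Q n + D) =o[atTop]
      fun n : ℕ => Real.exp (ε / 2 * n) := by
    refine (((hQ _ (half_pos hε)).const_mul_left _).add (hQ _ (half_pos hε))).add ?_
    refine isLittleO_const_left.2 (Or.inr ?_)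
    exact tendsto_norm_atTop_atTop.comp hexp
  obtain ⟨n₀, hn₀⟩ := eventually_atTop.1 (ho.bound one_pos)
  refine ⟨n₀, fun n hn => ?_⟩
  have hn' : (0 : ℝ) < n := by exact_mod_cast (Nat.zero_le n₀).trans_lt hn
  have h1 := hn₀ n hn.le
  rw [one_mul, Real.norm_of_nonneg (by positivity), Real.norm_of_nonneg (by positivity)] at h1
  have h2 := (Real.log_le_iff_le_exp (by positivity)).2 h1
  rw [Real.dist_eq, sub_zero, abs_of_nonneg (div_nonneg (hlog n) hn'.le), div_lt_iff₀ hn']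
  nlinarith

theorem tendsto_complexityTerm {Q : ℕ → ℕ} (hQ : SubExponential Q) {D : ℕ} (hD : 0 < D) (L : ℝ) :
    Tendsto (fun n : ℕ => complexityTerm L D (Q n) n) atTop (𝓝 0) := by
  have h1 : Tendsto (fun n : ℕ => √((n : ℝ)⁻¹)) atTop (𝓝 0) := by
    simpa using (tendsto_inv_atTop_zero.comp
      (tendsto_natCast_atTop_atTop (R := ℝ))).sqrt
  have h2 : Tendsto (fun n : ℕ => √(Real.log ((D : ℝ) * Q n + Q n + D) / n)) atTop (𝓝 0) := by
    simpa using (tendsto_log_div_of_subExponential hQ hD).sqrt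
  have h3 := ((h1.const_mul 2).add h2).const_mul ((2 : ℝ) ^ (3 / 2 : ℝ) * L)
  simp only [mul_zero, add_zero] at h3
  refine h3.congr fun n => ?_
  rw [complexityTerm, Real.sqrt_inv, Real.sqrt_div' _ n.cast_nonneg]
  ring

theorem tendsto_confidenceTerm (δ : ℝ) :
    Tendsto (fun n : ℕ => confidenceTerm δ n) atTop (𝓝 0) := by
  have h : Tendsto (fun n : ℕ => Real.log (1 / δ) / (2 * (n : ℝ))) atTop (𝓝 0) :=
    tendsto_const_nhds.div_atTop (tendsto_natCast_atTop_atTop.const_mul_atTop two_pos)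
  simpa [confidenceTerm] using h.sqrt

end PartitionwiseLinear

theorem theorem2 {Ω Y : Type*} [MeasurableSpace Ω] [MeasurableSpace Y]
    (ρ : Measure Ω) [IsProbabilityMeasure ρ]
    (D P N : ℕ) (hD : 0 < D) (hN : 0 < N)
    -- the exponent of the norm inside the groups
    (q : ℝ≥0∞) [Fact (1 ≤ q)]
    -- the partition activeness functions
    (f : Fin P → (Fin D → ℝ) → ℝ) (hf : ∀ p, Measurable (f p))
    (hf01 : ∀ p x, f p x = 0 ∨ f p x = 1)
    -- the loss function
    (ℓ : Y → ℝ → ℝ) (hℓ : Measurable (Function.uncurry ℓ))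
    (L : ℝ≥0) (hL : ∀ y, LipschitzWith L (ℓ y)) (hℓ01 : ∀ y t, ℓ y t ∈ Set.Icc (0 : ℝ) 1)
    -- the data distribution and the i.i.d. sample
    (μ : Measure ((Fin D → ℝ) × Y)) [IsProbabilityMeasure μ]
    (hμ : ∀ᵐ z ∂μ, ‖z.1‖ ≤ 1)
    (Z : Fin N → Ω → (Fin D → ℝ) × Y) (hZ : ∀ n, Measurable (Z n))
    (hZμ : ∀ n, Measure.map (Z n) ρ = μ) (hind : iIndepFun Z ρ)
    (δ : ℝ) (hδ0 : 0 < δ) (hδ1 : δ < 1) :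
    ENNReal.ofReal (1 - δ) ≤
        ρ {ω | ∀ A ∈ PartitionwiseLinear.weightClass D P q,
          PartitionwiseLinear.expectedLoss ℓ f μ A ≤
            PartitionwiseLinear.empiricalLoss ℓ f (fun n => Z n ω) A
              + PartitionwiseLinear.complexityTerm L D P N
              + PartitionwiseLinear.confidenceTerm δ N} ∧
      ∀ Q : ℕ → ℕ, PartitionwiseLinear.SubExponential Q →
        Tendsto
          (fun n : ℕ => PartitionwiseLinear.complexityTerm L D (Q n) n
            + PartitionwiseLinear.confidenceTerm δ n)
          atTop (𝓝 0) := by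
  constructor
  · obtain ⟨G, hGm, hG, hall⟩ := PartitionwiseLinear.le_measure_forall_weightClass (N := N)
      (q := q) μ hD hN hf hf01 hℓ hL hℓ01 hμ hδ0 hδ1
    have hmap : Measure.map (fun ω n => Z n ω) ρ = Measure.pi fun _ => μ := by
      rw [(iIndepFun_iff_map_fun_eq_pi_map fun n => (hZ n).aemeasurable).1 hind]
      simp only [hZμ]
    -- Measurability of `G` allows the pullback along the sample; the event in the statement only
    -- has to contain the result.
    rw [← hmap, Measure.map_apply (measurable_pi_lambda _ hZ) hGm] at hG
    exact hG.trans (measure_mono fun ω hω => hall _ hω)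
  · intro Q hQ
    simpa using (PartitionwiseLinear.tendsto_complexityTerm hQ hD L).add
      (PartitionwiseLinear.tendsto_confidenceTerm δ)
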